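/- Let $q$ be a prime power and let $m\ge 1$ and $n_1,n_2\ge 2$ be integers. A $q$-matroid on a finite-dimensional $\mathbb F_q$-vector space $E$ is a function $\rho$ from the set of subspaces of $E$ to the nonnegative integers such that, for all subspaces $A,B$ of $E$: $\rho(A)\le\dim A$; $\rho(A)\le\rho(B)$ whenever $A\le B$; and $\rho(A+B)+\rho(A\cap B)\le\rho(A)+\rho(B)$. Its rank is $\rho(E)$. For $0\le k\le n$, the uniform $q$-matroid $\mathcal U_{k,n}(q)$ is the $q$-matroid on $\mathbb F_q^n$ with $\rho(V)=\min\{k,\dim V\}$. The direct sum $\mathcal M_1\oplus\mathcal M_2$ of $q$-matroids $\mathcal M_i=(\mathbb F_q^{n_i},\rho_i)$ is the $q$-matroid on $\mathbb F_q^{n_1+n_2}=\mathbb F_q^{n_1}\oplus\mathbb F_q^{n_2}$ with $$\rho(V)=\dim V+\min_{X\le V}\bigl(\rho_1(\pi_1(X))+\rho_2(\pi_2(X))-\dim X\bigr),$$ where $\pi_i$ is the projection onto $\mathbb F_q^{n_i}$. A $q$-matroid $\mathcal M=(\mathbb F_q^n,\rho)$ is $\mathbb F_{q^m}$-representable if there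 is a matrix $G$ with $n$ columns and entries in $\mathbb F_{q^m}$, whose rank is the rank of $\mathcal M$, such that for every subspace $U\le\mathbb F_q^n$ one has $\rho(U)=\operatorname{rk}(GA^U)$, where $A^U$ is a matrix whose columns form a basis of $U$. Theorem. The direct sum $\mathcal U_{1,n_1}(q)\oplus\mathcal U_{1,n_2}(q)$ is $\mathbb F_{q^m}$-representable if at least one of the following holds: 1. $m$ is even and $m\ge 2\max\{n_1,n_2\}$; 2. $m\ge n_1n_2$; 3. $m=t_1t_2$ for some integers $t_1,t_2\ge 1$ with $t_1\ge n_1$ and $n_2\le \frac{t_1(t_2-1)}{2}+1$; 4. $m=t_1t_2$ for some integers $t_1,t_2$ with $t_1\ge n_1$, $t_1\ge n_2$ and $t_2\ge 2$; 5. $q=p^h$ and $m=p^r$ for some prime $p$ and some integers $h\ge 1$, $r\ge 0$, and $n_1+n_2-1\le \frac m2$. -/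

import Mathlib

/-- A `q`-matroid on a finite-dimensional `K`-vector space `E` (with `K` the field of `q` elements):
a rank function on the subspaces of `E` that is bounded by the dimension, monotone and submodular.
The values are nonnegative integers, so they are taken in `ℕ`. -/
@[ext]
structure QMatroid (K E : Type*) [Field K] [AddCommGroup E] [Module K E]
    [FiniteDimensional K E] where
  /-- the rank function -/
  rk : Submodule K E → ℕ
  rk_le_finrank : ∀ A, rk A ≤ Module.finrank K A
  rk_mono : ∀ A B, A ≤ B → rk A ≤ rk B
  rk_submod : ∀ A B, rk (A ⊔ B) + rk (A ⊓ B) ≤ rk A + rk B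

namespace QMatroid

section General

variable {K E E₁ E₂ : Type*} [Field K]
  [AddCommGroup E] [Module K E] [FiniteDimensional K E]
  [AddCommGroup E₁] [Module K E₁] [FiniteDimensional K E₁]
  [AddCommGroup E₂] [Module K E₂] [FiniteDimensional K E₂]

/-- The rank of a `q`-matroid is the rank of its ground space. -/
def rank (M : QMatroid K E) : ℕ := M.rk ⊤

/-- The rank function of the direct sum of `M₁` and `M₂`, on the subspaces of `E₁ × E₂`:
`V ↦ dim V + min_{X ≤ V} (ρ₁ (π₁ X) + ρ₂ (π₂ X) - dim X)`.
As `dim X ≤ dim V`, the term `dim V - dim X` is an exact subtraction in `ℕ`. -/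
noncomputable def directSumRk (M₁ : QMatroid K E₁) (M₂ : QMatroid K E₂)
    (V : Submodule K (E₁ × E₂)) : ℕ :=
  ⨅ X : {X : Submodule K (E₁ × E₂) // X ≤ V},
    (M₁.rk (X.1.map (LinearMap.fst K E₁ E₂)) + M₂.rk (X.1.map (LinearMap.snd K E₁ E₂))
      + (Module.finrank K V - Module.finrank K X.1))

theorem directSumRk_le (M₁ : QMatroid K E₁) (M₂ : QMatroid K E₂)
    {V X : Submodule K (E₁ × E₂)} (h : X ≤ V) :
    directSumRk M₁ M₂ V ≤
      M₁.rk (X.map (LinearMap.fst K E₁ E₂)) + M₂.rk (X.map (LinearMap.snd K E₁ E₂))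
        + (Module.finrank K V - Module.finrank K X) :=
  ciInf_le (OrderBot.bddBelow _) (⟨X, h⟩ : {X : Submodule K (E₁ × E₂) // X ≤ V})

theorem exists_directSumRk_eq (M₁ : QMatroid K E₁) (M₂ : QMatroid K E₂)
    (V : Submodule K (E₁ × E₂)) : ∃ X ≤ V, directSumRk M₁ M₂ V =
      M₁.rk (X.map (LinearMap.fst K E₁ E₂)) + M₂.rk (X.map (LinearMap.snd K E₁ E₂))
        + (Module.finrank K V - Module.finrank K X) := by
  have : Nonempty {X : Submodule K (E₁ × E₂) // X ≤ V} := ⟨⟨V, le_rfl⟩⟩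
  obtain ⟨X, hX⟩ := Nat.sInf_mem (Set.range_nonempty
    fun X : {X : Submodule K (E₁ × E₂) // X ≤ V} =>
      (M₁.rk (X.1.map (LinearMap.fst K E₁ E₂)) + M₂.rk (X.1.map (LinearMap.snd K E₁ E₂))
        + (Module.finrank K V - Module.finrank K X.1)))
  exact ⟨X.1, X.2, hX.symm⟩

theorem rk_map_submod {F : Type*} [AddCommGroup F] [Module K F]
    (M : QMatroid K E) (f : F →ₗ[K] E) (X Y : Submodule K F) :
    M.rk ((X ⊔ Y).map f) + M.rk ((X ⊓ Y).map f) ≤ M.rk (X.map f) + M.rk (Y.map f) := by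
  have h1 := M.rk_submod (X.map f) (Y.map f)
  have h2 := M.rk_mono _ _ (Submodule.map_inf_le f (p := X) (q := Y))
  rw [Submodule.map_sup]
  omega

/-- The direct sum of two `q`-matroids, with ground space `E₁ × E₂`. -/
noncomputable def directSum (M₁ : QMatroid K E₁) (M₂ : QMatroid K E₂) :
    QMatroid K (E₁ × E₂) where
  rk := directSumRk M₁ M₂
  rk_le_finrank V := by
    have h := directSumRk_le M₁ M₂ (bot_le : ⊥ ≤ V)
    have h1 := M₁.rk_le_finrank ⊥
    have h2 := M₂.rk_le_finrank ⊥
    simp only [Submodule.map_bot, finrank_bot] at h h1 h2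
    omega
  rk_mono V W hVW := by
    obtain ⟨X, hX, hXe⟩ := exists_directSumRk_eq M₁ M₂ W
    have h := directSumRk_le M₁ M₂ (inf_le_right : X ⊓ V ≤ V)
    have h1 := M₁.rk_mono _ _ (Submodule.map_mono (f := LinearMap.fst K E₁ E₂)
      (inf_le_left : X ⊓ V ≤ X))
    have h2 := M₂.rk_mono _ _ (Submodule.map_mono (f := LinearMap.snd K E₁ E₂)
      (inf_le_left : X ⊓ V ≤ X))
    have h3 := Submodule.finrank_sup_add_finrank_inf_eq X V
    have h4 := Submodule.finrank_mono (sup_le hX hVW)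
    omega
  rk_submod V W := by
    obtain ⟨X, hX, hXe⟩ := exists_directSumRk_eq M₁ M₂ V
    obtain ⟨Y, hY, hYe⟩ := exists_directSumRk_eq M₁ M₂ W
    have h := directSumRk_le M₁ M₂ (sup_le_sup hX hY)
    have h' := directSumRk_le M₁ M₂ (inf_le_inf hX hY)
    have h1 := rk_map_submod M₁ (LinearMap.fst K E₁ E₂) X Y
    have h2 := rk_map_submod M₂ (LinearMap.snd K E₁ E₂) X Y
    have h3 := Submodule.finrank_sup_add_finrank_inf_eq X Y
    have h4 := Submodule.finrank_sup_add_finrank_inf_eq V W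
    have h5 := Submodule.finrank_mono hX
    have h6 := Submodule.finrank_mono hY
    have h7 := Submodule.finrank_mono (sup_le_sup hX hY)
    have h8 := Submodule.finrank_mono (inf_le_inf hX hY)
    omega

/-- Transport of a `q`-matroid along an isomorphism of ground spaces. -/
def transport (M : QMatroid K E₁) (e : E₁ ≃ₗ[K] E₂) : QMatroid K E₂ where
  rk V := M.rk (V.map (e.symm : E₂ →ₗ[K] E₁))
  rk_le_finrank V := (M.rk_le_finrank _).trans (Submodule.finrank_map_le _ _)
  rk_mono _ _ h := M.rk_mono _ _ (Submodule.map_mono h)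
  rk_submod V W := rk_map_submod M _ V W

end General

section Coordinates

variable (K : Type*) [Field K]

/-- The uniform `q`-matroid of rank `k` on `K ^ n` (for `k ≤ n`). -/
noncomputable def uniform (k n : ℕ) : QMatroid K (Fin n → K) where
  rk V := min k (Module.finrank K V)
  rk_le_finrank _ := min_le_right _ _
  rk_mono _ _ h := min_le_min le_rfl (Submodule.finrank_mono h)
  rk_submod V W := by
    have h1 := Submodule.finrank_sup_add_finrank_inf_eq V W
    have h2 := Submodule.finrank_mono (inf_le_left : V ⊓ W ≤ V)
    have h3 := Submodule.finrank_mono (inf_le_right : V ⊓ W ≤ W)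
    omega

/-- The identification `K ^ n₁ ⊕ K ^ n₂ = K ^ (n₁ + n₂)` by concatenation of coordinates. -/
def concat (n₁ n₂ : ℕ) : ((Fin n₁ → K) × (Fin n₂ → K)) ≃ₗ[K] (Fin (n₁ + n₂) → K) :=
  (LinearEquiv.sumArrowLequivProdArrow (Fin n₁) (Fin n₂) K K).symm ≪≫ₗ
    LinearEquiv.funCongrLeft K K finSumFinEquiv.symm

theorem concat_apply (n₁ n₂ : ℕ) (v : (Fin n₁ → K) × (Fin n₂ → K)) :
    concat K n₁ n₂ v = Fin.append v.1 v.2 := by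
  ext i
  refine Fin.addCases (fun j => ?_) (fun j => ?_) i
  · simp only [concat, LinearEquiv.trans_apply, LinearEquiv.funCongrLeft_apply,
      LinearMap.funLeft_apply, finSumFinEquiv_symm_apply_castAdd, Fin.append_left]
    rfl
  · simp only [concat, LinearEquiv.trans_apply, LinearEquiv.funCongrLeft_apply,
      LinearMap.funLeft_apply, finSumFinEquiv_symm_apply_natAdd, Fin.append_right]
    rfl

variable {K}

/-- The direct sum of `q`-matroids with ground spaces `K ^ n₁` and `K ^ n₂`, as a `q`-matroid with
ground space `K ^ (n₁ + n₂)`. -/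
noncomputable def coordSum {n₁ n₂ : ℕ} (M₁ : QMatroid K (Fin n₁ → K))
    (M₂ : QMatroid K (Fin n₂ → K)) : QMatroid K (Fin (n₁ + n₂) → K) :=
  (M₁.directSum M₂).transport (concat K n₁ n₂)

/-- A matrix whose columns form a basis of the subspace `U` of `K ^ n`. -/
noncomputable def basisMatrix {n : ℕ} (U : Submodule K (Fin n → K)) :
    Matrix (Fin n) (Fin (Module.finrank K U)) K :=
  Matrix.of fun i j => (Module.finBasis K U j : Fin n → K) i

variable {L : Type*} [Field L] [Algebra K L]

/-- The rank function defined by a matrix `G` over an extension field `L`: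
`U ↦ rank (G * A)`, for a matrix `A` whose columns form a basis of `U`. -/
noncomputable def matrixRk {k n : ℕ} (G : Matrix (Fin k) (Fin n) L)
    (U : Submodule K (Fin n → K)) : ℕ :=
  (G * (basisMatrix U).map (algebraMap K L)).rank

/-- The `K`-linear map `v ↦ G v` from `K ^ n` to `L ^ k`. -/
noncomputable def matrixMap (K : Type*) [Field K] [Algebra K L] {k n : ℕ}
    (G : Matrix (Fin k) (Fin n) L) : (Fin n → K) →ₗ[K] (Fin k → L) :=
  (G.mulVecLin.restrictScalars K).comp ((Algebra.linearMap K L).compLeft (Fin n))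

/-- The rank `matrixRk G U` does not depend on the choice of the basis of `U`. -/
theorem matrixRk_eq {k n : ℕ} (G : Matrix (Fin k) (Fin n) L) (U : Submodule K (Fin n → K)) :
    matrixRk G U =
      Module.finrank L (Submodule.span L (U.map (matrixMap K G) : Set (Fin k → L))) := by
  rw [matrixRk, Matrix.rank_eq_finrank_span_cols]
  have hcol : Set.range (G * (basisMatrix U).map (algebraMap K L)).col =
      matrixMap K G '' (Set.range fun j => (Module.finBasis K U j : Fin n → K)) := by
    rw [← Set.range_comp]
    rfl
  have hU : U = Submodule.span K (Set.range fun j => (Module.finBasis K U j : Fin n → K)) := by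
    have h := congrArg (Submodule.map U.subtype) (Module.finBasis K U).span_eq
    rw [Submodule.map_span, Submodule.map_top, Submodule.range_subtype, ← Set.range_comp] at h
    exact h.symm
  rw [hcol]
  conv_rhs => rw [hU, Submodule.map_span, Submodule.span_span_of_tower]

/-- The `q`-matroid on `K ^ n` represented by a matrix `G` over an extension field `L` of `K`. -/
noncomputable def ofMatrix (K : Type*) [Field K] [Algebra K L] {k n : ℕ}
    (G : Matrix (Fin k) (Fin n) L) : QMatroid K (Fin n → K) where
  rk := matrixRk G
  rk_le_finrank U := by
    simpa [matrixRk] using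
      Matrix.rank_le_card_width (G * (basisMatrix U).map (algebraMap K L))
  rk_mono U V h := by
    rw [matrixRk_eq, matrixRk_eq]
    exact Submodule.finrank_mono (Submodule.span_mono (Submodule.map_mono h))
  rk_submod U V := by
    simp only [matrixRk_eq]
    have h1 : Submodule.span L ((U ⊔ V).map (matrixMap K G) : Set (Fin k → L)) ≤
        Submodule.span L (U.map (matrixMap K G) : Set (Fin k → L)) ⊔
          Submodule.span L (V.map (matrixMap K G) : Set (Fin k → L)) := by
      rw [Submodule.span_le]
      rintro _ ⟨w, hw, rfl⟩
      obtain ⟨u, hu, v, hv, rfl⟩ := Submodule.mem_sup.1 hw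
      rw [map_add]
      exact Submodule.add_mem_sup (Submodule.subset_span ⟨u, hu, rfl⟩)
        (Submodule.subset_span ⟨v, hv, rfl⟩)
    have h2 : Submodule.span L ((U ⊓ V).map (matrixMap K G) : Set (Fin k → L)) ≤
        Submodule.span L (U.map (matrixMap K G) : Set (Fin k → L)) ⊓
          Submodule.span L (V.map (matrixMap K G) : Set (Fin k → L)) :=
      le_inf (Submodule.span_mono (Submodule.map_mono inf_le_left))
        (Submodule.span_mono (Submodule.map_mono inf_le_right))
    have h3 := Submodule.finrank_mono h1
    have h4 := Submodule.finrank_mono h2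
    have h5 := Submodule.finrank_sup_add_finrank_inf_eq
      (Submodule.span L (U.map (matrixMap K G) : Set (Fin k → L)))
      (Submodule.span L (V.map (matrixMap K G) : Set (Fin k → L)))
    omega

/-- A `q`-matroid `M` on `K ^ n` is `L`-representable if it is the `q`-matroid represented by some
matrix with `n` columns and entries in `L` whose rank is the rank of `M`. -/
def IsRepresentable (L : Type*) [Field L] [Algebra K L] {n : ℕ}
    (M : QMatroid K (Fin n → K)) : Prop :=
  ∃ (k : ℕ) (G : Matrix (Fin k) (Fin n) L), G.rank = M.rank ∧ M = ofMatrix K G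

end Coordinates

end QMatroid

/-! Take a two-row block diagonal matrix whose rows are given by injective `K`-linear maps `f`, `g`
into `L` with images in `A` and `B`. Its rank function never exceeds that of the direct sum. The two
agree as soon as a subspace of matrix rank 1 with both projections nonzero is a line over `K`. Rank
1 means that the minors `f v₁ * g w₂ - f w₁ * g v₂` vanish, so it suffices that `A` and `B` be
product-injective (`isRepresentable_of_isProductInjective`).

It remains to find such pairs of dimensions at least `n₁`, `n₂`. For `n₁ n₂ ≤ m`, powers of a
primitive element make all products of basis vectors independent. If `A` is a subfield `F`, then `B`
only has to be scattered over `F`, and a greedy count builds it. Otherwise `B = {y + γ σ y : y ∈ Y}`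
with `σ` generating the Galois group: if `A Y` and `A σ(Y)` lie in `W` and `W ∩ γ W = 0`, one
equation splits into two, forcing `y / y'` to be fixed by `σ`. Here `W` is a proper subfield, or a
kernel of a power of `σ - 1` when `m` is a power of the characteristic. -/

/-- Subspaces `A`, `B` of a field extension for which the multiplication map from pairs of points
of `A` and `B` to points of `L` is injective. -/
def IsProductInjective {K L : Type*} [Field K] [Field L] [Algebra K L]
    (A B : Submodule K L) : Prop :=
  ∀ a ∈ A, ∀ a' ∈ A, ∀ b ∈ B, ∀ b' ∈ B, a' ≠ 0 → b' ≠ 0 → a * b' = a' * b → ∃ c : K, a = c • a'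

theorem exists_injective_mem_of_le_finrank {K L : Type*} [Field K] [AddCommGroup L] [Module K L]
    [FiniteDimensional K L] (A : Submodule K L) {n : ℕ} (hn : n ≤ Module.finrank K A) :
    ∃ f : (Fin n → K) →ₗ[K] L, Function.Injective f ∧ ∀ x, f x ∈ A := by
  obtain ⟨f, hf⟩ := (finrank_le_iff_exists_linearMap (R := K) (M := Fin n → K) (M' := A)).1
    (by simpa using hn)
  exact ⟨A.subtype ∘ₗ f, A.injective_subtype.comp hf, fun x => (f x).2⟩

/-! ### Block diagonal matrices and the direct sum rank -/

namespace QMatroid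

section

variable {K E : Type*} [Field K] [AddCommGroup E] [Module K E] [FiniteDimensional K E]

/-- Submodularity applied to `X` and a complement of `X` in `V`. -/
theorem rk_le_rk_add_finrank_sub (M : QMatroid K E) {X V : Submodule K E} (h : X ≤ V) :
    M.rk V ≤ M.rk X + (Module.finrank K V - Module.finrank K X) := by
  obtain ⟨C, hC⟩ := Submodule.exists_isCompl X
  have hV : X ⊔ (C ⊓ V) = V := by
    rw [← sup_inf_assoc_of_le _ h, hC.sup_eq_top, top_inf_eq]
  have hX : X ⊓ (C ⊓ V) = ⊥ := by
    rw [← inf_assoc, hC.inf_eq_bot, bot_inf_eq]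
  have h1 := M.rk_submod X (C ⊓ V)
  have h2 := Submodule.finrank_sup_add_finrank_inf_eq X (C ⊓ V)
  have h3 := M.rk_le_finrank (C ⊓ V)
  rw [hV] at h1 h2
  rw [hX, finrank_bot] at h2
  omega

end

variable {K L : Type*} [Field K] [Field L] [Algebra K L]

/-- The block diagonal matrix with two rows whose row spaces are described by two linear maps. -/
noncomputable def blockMatrix {n₁ n₂ : ℕ} (f : (Fin n₁ → K) →ₗ[K] L) (g : (Fin n₂ → K) →ₗ[K] L) :
    Matrix (Fin 2) (Fin (n₁ + n₂)) L :=
  Matrix.of ![Fin.append (fun i => f (Pi.single i 1)) 0, Fin.append 0 (fun i => g (Pi.single i 1))]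

theorem matrixMap_blockMatrix {n₁ n₂ : ℕ} (f : (Fin n₁ → K) →ₗ[K] L) (g : (Fin n₂ → K) →ₗ[K] L)
    (v : (Fin n₁ → K) × (Fin n₂ → K)) :
    matrixMap K (blockMatrix f g) (concat K n₁ n₂ v) = ![f v.1, g v.2] := by
  have key : ∀ (n : ℕ) (f : (Fin n → K) →ₗ[K] L) (x : Fin n → K),
      ∑ i, f (Pi.single i 1) * algebraMap K L (x i) = f x := by
    intro n f x
    conv_rhs => rw [LinearMap.pi_apply_eq_sum_univ f x]
    refine Finset.sum_congr rfl fun i _ => ?_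
    rw [Algebra.smul_def, mul_comm]
    congr 2
    ext j
    simp [Pi.single_apply, eq_comm]
  rw [concat_apply]
  ext i
  fin_cases i
  · simp [matrixMap, blockMatrix, Matrix.mulVec, dotProduct, Fin.sum_univ_add, key]
  · simp [matrixMap, blockMatrix, Matrix.mulVec, dotProduct, Fin.sum_univ_add, key]

/-- The rank function of the block matrix in terms of the subspaces of `K ^ n₁ × K ^ n₂`. -/
theorem matrixRk_blockMatrix {n₁ n₂ : ℕ} (f : (Fin n₁ → K) →ₗ[K] L) (g : (Fin n₂ → K) →ₗ[K] L)
    (V : Submodule K ((Fin n₁ → K) × (Fin n₂ → K))) :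
    matrixRk (blockMatrix f g) (V.map (concat K n₁ n₂ : _ →ₗ[K] (Fin (n₁ + n₂) → K))) =
      Module.finrank L (Submodule.span L ((fun v => ![f v.1, g v.2]) ''
        (V : Set ((Fin n₁ → K) × (Fin n₂ → K))))) := by
  rw [matrixRk_eq]
  have h : (((V.map (concat K n₁ n₂ : _ →ₗ[K] (Fin (n₁ + n₂) → K))).map
      (matrixMap K (blockMatrix f g)) : Submodule K (Fin 2 → L)) : Set (Fin 2 → L)) =
      (fun v => ![f v.1, g v.2]) '' (V : Set ((Fin n₁ → K) × (Fin n₂ → K))) := by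
    ext w
    simp [← matrixMap_blockMatrix]
  rw [h]

theorem det_eq_of_finrank_span_le_one {x y : Fin 2 → L} {S : Set (Fin 2 → L)}
    (hS : Module.finrank L (Submodule.span L S) ≤ 1) (hx : x ∈ S) (hy : y ∈ S) :
    x 0 * y 1 = y 0 * x 1 := by
  obtain ⟨z, hz⟩ := (finrank_le_one_iff).1 hS
  obtain ⟨c, hc⟩ := hz ⟨x, Submodule.subset_span hx⟩
  obtain ⟨d, hd⟩ := hz ⟨y, Submodule.subset_span hy⟩
  have hc' : c • (z : Fin 2 → L) = x := congrArg Subtype.val hc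
  have hd' : d • (z : Fin 2 → L) = y := congrArg Subtype.val hd
  rw [← hc', ← hd']
  simp only [Pi.smul_apply, smul_eq_mul]
  ring

/-- For each `X ≤ V`, passing from `X` to `V` costs at most the codimension, and `X` lies in the sum
of its two projections, each of rank at most 1 because only one row of the matrix sees it. -/
theorem matrixRk_le_directSumRk {n₁ n₂ : ℕ}
    (f : (Fin n₁ → K) →ₗ[K] L) (g : (Fin n₂ → K) →ₗ[K] L)
    (V : Submodule K ((Fin n₁ → K) × (Fin n₂ → K))) :
    matrixRk (blockMatrix f g) (V.map (concat K n₁ n₂ : _ →ₗ[K] (Fin (n₁ + n₂) → K))) ≤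
      directSumRk (uniform K 1 n₁) (uniform K 1 n₂) V := by
  set M := (ofMatrix K (blockMatrix f g)).transport (concat K n₁ n₂).symm with hM
  have hrk : ∀ W, M.rk W = matrixRk (blockMatrix f g)
    (W.map (concat K n₁ n₂ : _ →ₗ[K] (Fin (n₁ + n₂) → K))) := fun W => rfl
  rw [← hrk]
  obtain ⟨X, hX, hXe⟩ := exists_directSumRk_eq (uniform K 1 n₁) (uniform K 1 n₂) V
  rw [hXe]
  refine (M.rk_le_rk_add_finrank_sub hX).trans (Nat.add_le_add_right ?_ _)
  set P := X.map (LinearMap.fst K (Fin n₁ → K) (Fin n₂ → K))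
  set Q := X.map (LinearMap.snd K (Fin n₁ → K) (Fin n₂ → K))
  have h1 : M.rk (P.map (LinearMap.inl K _ _)) ≤ min 1 (Module.finrank K P) := by
    refine le_min ?_ ((M.rk_le_finrank _).trans (Submodule.finrank_map_le _ _))
    rw [hrk, matrixRk_blockMatrix]
    refine (Submodule.finrank_mono (Submodule.span_le.2 ?_ : _ ≤ Submodule.span L {(![1, 0] : Fin 2 → L)})).trans
      (finrank_span_le_card _) |>.trans (by simp)
    rintro _ ⟨_, ⟨x, -, rfl⟩, rfl⟩
    refine Submodule.mem_span_singleton.2 ⟨f x, ?_⟩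
    ext i; fin_cases i <;> simp
  have h2 : M.rk (Q.map (LinearMap.inr K _ _)) ≤ min 1 (Module.finrank K Q) := by
    refine le_min ?_ ((M.rk_le_finrank _).trans (Submodule.finrank_map_le _ _))
    rw [hrk, matrixRk_blockMatrix]
    refine (Submodule.finrank_mono (Submodule.span_le.2 ?_ : _ ≤ Submodule.span L {(![0, 1] : Fin 2 → L)})).trans
      (finrank_span_le_card _) |>.trans (by simp)
    rintro _ ⟨_, ⟨x, -, rfl⟩, rfl⟩
    refine Submodule.mem_span_singleton.2 ⟨g x, ?_⟩
    ext i; fin_cases i <;> simp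
  have h3 : X ≤ P.map (LinearMap.inl K _ _) ⊔ Q.map (LinearMap.inr K _ _) := by
    intro v hv
    have : v = LinearMap.inl K _ _ v.1 + LinearMap.inr K _ _ v.2 := by simp
    rw [this]
    exact Submodule.add_mem_sup (Submodule.mem_map_of_mem (Submodule.mem_map_of_mem hv))
      (Submodule.mem_map_of_mem (Submodule.mem_map_of_mem hv))
  have h4 := M.rk_mono _ _ h3
  have h5 := M.rk_submod (P.map (LinearMap.inl K _ _)) (Q.map (LinearMap.inr K _ _))
  change M.rk X ≤ min 1 (Module.finrank K P) + min 1 (Module.finrank K Q)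
  omega

/-- Only `X = ⊥` and `X = V` are needed in the minimum: they bound the direct sum rank by `dim V`
and by the number of nonzero projections. The sole delicate case is matrix rank 1 with two nonzero
projections, where `hfg` gives `dim V = 1`. -/
theorem directSumRk_le_matrixRk {n₁ n₂ : ℕ}
    (f : (Fin n₁ → K) →ₗ[K] L) (g : (Fin n₂ → K) →ₗ[K] L) (hf : Function.Injective f)
    (hg : Function.Injective g)
    (hfg : ∀ x x' y y', f x' ≠ 0 → g y' ≠ 0 → f x * g y' = f x' * g y → ∃ c : K, f x = c • f x')
    (V : Submodule K ((Fin n₁ → K) × (Fin n₂ → K))) :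
    directSumRk (uniform K 1 n₁) (uniform K 1 n₂) V ≤
      matrixRk (blockMatrix f g) (V.map (concat K n₁ n₂ : _ →ₗ[K] (Fin (n₁ + n₂) → K))) := by
  rw [matrixRk_blockMatrix]
  set S := (fun v : (Fin n₁ → K) × (Fin n₂ → K) => ![f v.1, g v.2]) '' (V : Set _) with hS
  have hzero : directSumRk (uniform K 1 n₁) (uniform K 1 n₂) V ≤ Module.finrank K V := by
    simpa [uniform] using directSumRk_le (uniform K 1 n₁) (uniform K 1 n₂) (bot_le : ⊥ ≤ V)
  have htop : directSumRk (uniform K 1 n₁) (uniform K 1 n₂) V ≤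
      min 1 (Module.finrank K (V.map (LinearMap.fst K _ _))) +
        min 1 (Module.finrank K (V.map (LinearMap.snd K _ _))) := by
    simpa [uniform] using directSumRk_le (uniform K 1 n₁) (uniform K 1 n₂) (le_refl V)
  rcases lt_or_ge 1 (Module.finrank L (Submodule.span L S)) with h | h
  · omega
  have hdet : ∀ v ∈ V, ∀ w ∈ V, f v.1 * g w.2 = f w.1 * g v.2 := fun v hv w hw => by
    simpa using det_eq_of_finrank_span_le_one h (Set.mem_image_of_mem _ hv)
      (Set.mem_image_of_mem _ hw)
  by_cases hV : V = ⊥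
  · have : Module.finrank K V = 0 := by rw [hV, finrank_bot]
    omega
  obtain ⟨u, hu, hu0⟩ := V.ne_bot_iff.1 hV
  have hpos : 0 < Module.finrank L (Submodule.span L S) := by
    rw [Nat.pos_iff_ne_zero, Ne, Submodule.finrank_eq_zero, Submodule.span_eq_bot]
    intro hall
    have h0 := hall _ (Set.mem_image_of_mem _ hu)
    have h1 := congrFun h0 0
    have h2 := congrFun h0 1
    simp only [Matrix.cons_val_zero, Pi.zero_apply, Matrix.cons_val_one] at h1 h2
    exact hu0 (Prod.ext (hf (by simpa using h1)) (hg (by simpa using h2)))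
  suffices directSumRk (uniform K 1 n₁) (uniform K 1 n₂) V ≤ 1 by omega
  by_cases hfst : V.map (LinearMap.fst K _ _) = ⊥
  · rw [hfst, finrank_bot] at htop
    omega
  by_cases hsnd : V.map (LinearMap.snd K _ _) = ⊥
  · rw [hsnd, finrank_bot] at htop
    omega
  obtain ⟨_, ⟨w, hw, rfl⟩, hw0⟩ := (Submodule.ne_bot_iff _).1 hfst
  obtain ⟨_, ⟨v, hv, rfl⟩, hv0⟩ := (Submodule.ne_bot_iff _).1 hsnd
  have hfw : f w.1 ≠ 0 := fun h => hw0 (hf (by simpa using h))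
  have hgv : g v.2 ≠ 0 := fun h => hv0 (hg (by simpa using h))
  -- The minor of `w` and `v` shows that the single vector `v` has both components nonzero; it will
  -- span `V`.
  have hfv : f v.1 ≠ 0 := by
    intro h0
    have := hdet w hw v hv
    rw [h0, zero_mul] at this
    exact mul_ne_zero hfw hgv this
  refine hzero.trans (finrank_le_one ⟨v, hv⟩ ?_)
  rintro ⟨x, hx⟩
  have hxv := hdet x hx v hv
  obtain ⟨c, hc⟩ := hfg _ _ _ _ hfv hgv hxv
  refine ⟨c, Subtype.ext (Prod.ext (hf ?_) (hg ?_))⟩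
  · simp [hc]
  · rw [hc, smul_mul_assoc, ← mul_smul_comm] at hxv
    simpa using mul_left_cancel₀ hfv hxv

theorem rk_coordSum_map {n₁ n₂ : ℕ} (M₁ : QMatroid K (Fin n₁ → K)) (M₂ : QMatroid K (Fin n₂ → K))
    (W : Submodule K ((Fin n₁ → K) × (Fin n₂ → K))) :
    (coordSum M₁ M₂).rk (W.map (concat K n₁ n₂ : _ →ₗ[K] (Fin (n₁ + n₂) → K))) =
      directSumRk M₁ M₂ W := by
  change directSumRk M₁ M₂ (Submodule.map _ (Submodule.map _ W)) = _
  rw [← Submodule.map_comp, LinearEquiv.symm_comp, Submodule.map_id]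

theorem isRepresentable_of_isProductInjective [FiniteDimensional K L] {n₁ n₂ : ℕ}
    {A B : Submodule K L} (hA : n₁ ≤ Module.finrank K A) (hB : n₂ ≤ Module.finrank K B)
    (hAB : IsProductInjective A B) :
    IsRepresentable L (coordSum (uniform K 1 n₁) (uniform K 1 n₂)) := by
  obtain ⟨f, hf, hfA⟩ := exists_injective_mem_of_le_finrank A hA
  obtain ⟨g, hg, hgB⟩ := exists_injective_mem_of_le_finrank B hB
  have heq : coordSum (uniform K 1 n₁) (uniform K 1 n₂) = ofMatrix K (blockMatrix f g) := by
    ext V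
    obtain ⟨W, rfl⟩ : ∃ W : Submodule K ((Fin n₁ → K) × (Fin n₂ → K)),
        W.map (concat K n₁ n₂ : _ →ₗ[K] (Fin (n₁ + n₂) → K)) = V :=
      ⟨V.comap (concat K n₁ n₂ : _ →ₗ[K] (Fin (n₁ + n₂) → K)),
        Submodule.map_comap_eq_of_surjective (concat K n₁ n₂).surjective V⟩
    rw [rk_coordSum_map]
    exact le_antisymm (directSumRk_le_matrixRk f g hf hg
      (fun x x' y y' => hAB _ (hfA x) _ (hfA x') _ (hgB y) _ (hgB y')) W)
      (matrixRk_le_directSumRk f g W)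
  refine ⟨2, blockMatrix f g, ?_, heq⟩
  rw [heq]
  change _ = matrixRk _ ⊤
  rw [matrixRk_eq, Matrix.rank_eq_finrank_span_cols]
  -- The columns of the matrix and the image of all of `K ^ n` have the same `L`-span.
  refine le_antisymm (Submodule.finrank_mono (Submodule.span_mono ?_))
    (Submodule.finrank_mono (Submodule.span_le.2 ?_))
  · rintro _ ⟨j, rfl⟩
    refine ⟨Pi.single j 1, trivial, ?_⟩
    ext i
    simp [matrixMap, Matrix.mulVec, dotProduct, Pi.single_apply, apply_ite (algebraMap K L)]
  · rintro _ ⟨x, -, rfl⟩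
    rw [← Matrix.range_mulVecLin]
    exact ⟨_, rfl⟩

end QMatroid

/-! ### Product-injective pairs from powers and from twisting -/

section

variable {K L : Type*} [Field K] [Field L] [Algebra K L]

/-- The condition is symmetric: given `a * b' = a' * b`, the ratios `a / a'` and `b / b'` coincide.
-/
theorem isProductInjective_of_ratio {A B : Submodule K L}
    (h : ∀ a ∈ A, ∀ a' ∈ A, ∀ b ∈ B, ∀ b' ∈ B, a' ≠ 0 → b' ≠ 0 → a * b' = a' * b →
      ∃ c : K, b = c • b') : IsProductInjective A B := by
  intro a ha a' ha' b hb b' hb' ha0 hb0 hab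
  obtain ⟨c, rfl⟩ := h a ha a' ha' b hb b' hb' ha0 hb0 hab
  refine ⟨c, mul_right_cancel₀ hb0 ?_⟩
  rw [hab, mul_smul_comm, smul_mul_assoc]

/-- The powers `θ ^ i` with `i < n₁` and `θ ^ (n₁ * j)` with `j < n₂` span such a pair when `θ` has
degree at least `n₁ * n₂`. -/
theorem exists_isProductInjective_of_mul_le [FiniteDimensional K L] [Algebra.IsSeparable K L]
    {n₁ n₂ : ℕ} (hn₁ : 0 < n₁) (hn₂ : 0 < n₂) (h : n₁ * n₂ ≤ Module.finrank K L) :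
    ∃ A B : Submodule K L, n₁ ≤ Module.finrank K A ∧ n₂ ≤ Module.finrank K B ∧
      IsProductInjective A B := by
  obtain ⟨θ, hθ⟩ := Field.exists_primitive_element K L
  have hdeg : (minpoly K θ).natDegree = Module.finrank K L :=
    (Field.primitive_element_iff_minpoly_natDegree_eq K θ).1 hθ
  set u : Fin n₂ × Fin n₁ → L := fun p => θ ^ ((p.2 : ℕ) + n₁ * p.1) with hu
  have hu_li : LinearIndependent K u := by
    -- The exponents `i + n₁ * j` take each value below `n₁ * n₂` once, so these are distinct powers
    -- below the degree of `θ`.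
    have := (linearIndependent_pow (K := K) θ).comp
      (fun p : Fin n₂ × Fin n₁ => Fin.castLE (by rwa [hdeg, mul_comm]) (finProdFinEquiv p)) ?_
    · exact this
    · exact (Fin.castLE_injective _).comp finProdFinEquiv.injective
  have hA_li : LinearIndependent K fun i : Fin n₁ => u (⟨0, hn₂⟩, i) :=
    hu_li.comp _ (Prod.mk_right_injective _)
  have hB_li : LinearIndependent K fun j : Fin n₂ => u (j, ⟨0, hn₁⟩) :=
    hu_li.comp _ (Prod.mk_left_injective _)
  refine ⟨Submodule.span K (Set.range fun i : Fin n₁ => u (⟨0, hn₂⟩, i)),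
    Submodule.span K (Set.range fun j : Fin n₂ => u (j, ⟨0, hn₁⟩)), ?_, ?_, ?_⟩
  · rw [finrank_span_eq_card hA_li, Fintype.card_fin]
  · rw [finrank_span_eq_card hB_li, Fintype.card_fin]
  intro a ha a' ha' b hb b' hb' ha0 hb0 hab
  obtain ⟨x, rfl⟩ := (Submodule.mem_span_range_iff_exists_fun K).1 ha
  obtain ⟨x', rfl⟩ := (Submodule.mem_span_range_iff_exists_fun K).1 ha'
  obtain ⟨y, rfl⟩ := (Submodule.mem_span_range_iff_exists_fun K).1 hb
  obtain ⟨y', rfl⟩ := (Submodule.mem_span_range_iff_exists_fun K).1 hb'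
  have hprod : ∀ (x : Fin n₁ → K) (y : Fin n₂ → K),
      (∑ i, x i • u (⟨0, hn₂⟩, i)) * (∑ j, y j • u (j, ⟨0, hn₁⟩)) =
        ∑ p : Fin n₂ × Fin n₁, (y p.1 * x p.2) • u p := by
    intro x y
    rw [mul_comm, Finset.sum_mul_sum, Fintype.sum_prod_type]
    refine Finset.sum_congr rfl fun j _ => Finset.sum_congr rfl fun i _ => ?_
    rw [smul_mul_smul_comm]
    congr 1
    simp only [hu, mul_zero, add_zero, zero_add]
    ring
  rw [hprod, hprod, ← sub_eq_zero, ← Finset.sum_sub_distrib] at hab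
  simp only [← sub_smul] at hab
  have hcoeff : ∀ j i, y' j * x i = y j * x' i := fun j i =>
    sub_eq_zero.1 (Fintype.linearIndependent_iff.1 hu_li _ hab (j, i))
  obtain ⟨j, hj⟩ : ∃ j, y' j ≠ 0 := by
    by_contra! hall
    simp [hall] at hb0
  refine ⟨y j / y' j, ?_⟩
  rw [Finset.smul_sum]
  refine Finset.sum_congr rfl fun i _ => ?_
  rw [smul_smul, div_mul_eq_mul_div, ← hcoeff j i, mul_div_cancel_left₀ _ hj]

/-- With `b = y + γ σ y` and `b' = y' + γ σ y'`, the relation `a b' = a' b` reads `a y' - a' y = γ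
(a' σ y - a σ y')`, both differences lying in `W`. Hence both vanish, and `y / y' = a / a' = σ y / σ
y'` is fixed by `σ`. -/
theorem isProductInjective_twist [FiniteDimensional K L] {A Y W : Submodule K L} (σ : L ≃ₐ[K] L)
    (hσ : ∀ x, σ x = x → ∃ c : K, x = algebraMap K L c) {γ : L}
    (hγ : ∀ u ∈ W, ∀ v ∈ W, u = γ * v → v = 0) (hA : A ≠ ⊥)
    (hAY : ∀ a ∈ A, ∀ y ∈ Y, a * y ∈ W) (hAσY : ∀ a ∈ A, ∀ y ∈ Y, a * σ y ∈ W) :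
    ∃ B : Submodule K L, Module.finrank K Y = Module.finrank K B ∧ IsProductInjective A B := by
  set φ : L →ₗ[K] L := LinearMap.id + (LinearMap.mulLeft K γ).comp σ.toLinearMap with hφ
  have hφa : ∀ y, φ y = y + γ * σ y := fun y => rfl
  obtain ⟨a₀, ha₀, ha₀'⟩ := A.ne_bot_iff.1 hA
  refine ⟨Y.map φ, ?_, isProductInjective_of_ratio ?_⟩
  · have hinj : Function.Injective (φ.domRestrict Y) := by
      rw [injective_iff_map_eq_zero]
      rintro ⟨y, hy⟩ hy0
      rw [LinearMap.domRestrict_apply, hφa] at hy0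
      -- Multiplying `y + γ σ y = 0` by a nonzero `a₀ ∈ A` moves the relation into `W`.
      have h1 := hγ (-(a₀ * y)) (W.neg_mem (hAY _ ha₀ _ hy)) _ (hAσY _ ha₀ _ hy)
        (by linear_combination -a₀ * hy0)
      simpa [ha₀'] using h1
    rw [← LinearMap.range_domRestrict, LinearMap.finrank_range_of_inj hinj]
  rintro a ha a' ha' _ ⟨y, hy, rfl⟩ _ ⟨y', hy', rfl⟩ ha0 hb0 hab
  rw [hφa, hφa] at hab
  have h1 : a' * σ y - a * σ y' = 0 := by
    have : a * y' - a' * y = γ * (a' * σ y - a * σ y') := by linear_combination hab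
    exact hγ _ (W.sub_mem (hAY _ ha _ hy') (hAY _ ha' _ hy)) _
      (W.sub_mem (hAσY _ ha' _ hy) (hAσY _ ha _ hy')) this
  have h2 : a * y' = a' * y := by linear_combination hab + γ * h1
  have hy0 : y' ≠ 0 := by
    rintro rfl
    simp at hb0
  have hσy0 : σ y' ≠ 0 := by simpa using hy0
  obtain ⟨c, hc⟩ := hσ (y / y') (by
    rw [map_div₀, div_eq_div_iff hσy0 hy0]
    refine mul_left_cancel₀ ha0 ?_
    linear_combination y' * h1 + σ y' * h2)
  refine ⟨c, ?_⟩
  rw [← map_smul, Algebra.smul_def, ← hc, div_mul_cancel₀ _ hy0]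

/-- Elements killed by `(σ - 1) ^ (i + 1)` behave like polynomials of degree at most `i`. Induction
on `i + j` through the twisted Leibniz rule `N (a b) = N a * σ b + a * N b`; the kernels are
`σ`-stable. -/
theorem mul_mem_ker_sub_one_pow (σ : L ≃ₐ[K] L) (i j : ℕ) {a b : L}
    (ha : a ∈ LinearMap.ker ((σ.toLinearMap - 1 : Module.End K L) ^ (i + 1)))
    (hb : b ∈ LinearMap.ker ((σ.toLinearMap - 1 : Module.End K L) ^ (j + 1))) :
    a * b ∈ LinearMap.ker ((σ.toLinearMap - 1 : Module.End K L) ^ (i + j + 1)) := by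
  set N : Module.End K L := σ.toLinearMap - 1 with hN
  have hNa : ∀ x, N x = σ x - x := fun x => rfl
  have hmem : ∀ (n : ℕ) (x : L), x ∈ LinearMap.ker (N ^ (n + 1)) ↔ N x ∈ LinearMap.ker (N ^ n) :=
    fun n x => by rw [LinearMap.mem_ker, LinearMap.mem_ker, pow_succ, Module.End.mul_apply]
  have hσN : ∀ n, ∀ y ∈ LinearMap.ker (N ^ n), σ y ∈ LinearMap.ker (N ^ n) := by
    intro n y hy
    have : σ y = N y + y := by simp [hNa]
    rw [this]
    refine Submodule.add_mem _ ?_ hy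
    rw [← hmem, LinearMap.mem_ker, pow_succ', Module.End.mul_apply, LinearMap.mem_ker.1 hy,
      map_zero]
  induction hn : i + j generalizing i j a b with
  | zero =>
    obtain ⟨rfl, rfl⟩ : i = 0 ∧ j = 0 := by omega
    rw [hmem, pow_zero, LinearMap.mem_ker, Module.End.one_apply, hNa, sub_eq_zero] at ha hb ⊢
    rw [map_mul, ha, hb]
  | succ n ih =>
    have hprod : N (a * b) = N a * σ b + a * N b := by
      simp only [hNa, map_mul]
      ring
    rw [hmem] at ha hb ⊢
    rw [hprod]
    refine Submodule.add_mem _ ?_ ?_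
    · rcases i with _ | i
      · rw [pow_zero, LinearMap.mem_ker, Module.End.one_apply] at ha
        rw [ha, zero_mul]
        exact Submodule.zero_mem _
      · exact ih i j ha (hσN _ _ ((hmem _ _).2 hb)) (by omega)
    · rcases j with _ | j
      · rw [pow_zero, LinearMap.mem_ker, Module.End.one_apply] at hb
        rw [hb, mul_zero]
        exact Submodule.zero_mem _
      · exact ih i j ((hmem _ _).2 ha) hb (by omega)

end

/-! ### Finite fields: subfields, counting, and kernels of powers of `σ - 1` -/

section

variable {K L : Type*} [Field K] [Field L] [Algebra K L] [FiniteDimensional K L]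

theorem exists_algEquiv_forall_mem_zpowers [Finite K] :
    ∃ σ : L ≃ₐ[K] L, (∀ τ, τ ∈ Subgroup.zpowers σ) ∧ orderOf σ = Module.finrank K L ∧
      ∀ x, σ x = x → ∃ c : K, x = algebraMap K L c := by
  have : Finite L := Module.finite_of_finite K
  obtain ⟨σ, hσ⟩ := IsCyclic.exists_generator (α := L ≃ₐ[K] L)
  refine ⟨σ, hσ, ?_, fun x hx => ?_⟩
  · rw [orderOf_eq_card_of_forall_mem_zpowers hσ, IsGalois.card_aut_eq_finrank]
  · obtain ⟨c, hc⟩ := (IsGalois.mem_range_algebraMap_iff_fixed (F := K) x).2 fun τ => by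
      have hle : Subgroup.zpowers σ ≤ MulAction.stabilizer (L ≃ₐ[K] L) x := by
        rw [Subgroup.zpowers_le]
        exact hx
      exact hle (hσ τ)
    exact ⟨c, hc.symm⟩

/-- The fixed field of `σ ^ t₁`, which has order `t₂` for a generator `σ` of the Galois group. -/
theorem exists_intermediateField_finrank_eq [Finite K] {t₁ t₂ : ℕ}
    (h : Module.finrank K L = t₁ * t₂) :
    ∃ F : IntermediateField K L, Module.finrank K F = t₁ := by
  obtain ⟨σ, -, hσ, -⟩ := exists_algEquiv_forall_mem_zpowers (K := K) (L := L)
  have hpos : 0 < t₁ * t₂ := h ▸ Module.finrank_pos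
  refine ⟨IntermediateField.fixedField (Subgroup.zpowers (σ ^ t₁)), ?_⟩
  have h1 := IntermediateField.finrank_fixedField_eq_card (Subgroup.zpowers (σ ^ t₁))
  have ht₁ : t₁ ≠ 0 := (Nat.pos_of_mul_pos_right hpos).ne'
  rw [Nat.card_zpowers, orderOf_pow_of_dvd ht₁ (by rw [hσ, h]; exact dvd_mul_right _ _), hσ, h,
    Nat.mul_div_cancel_left _ (Nat.pos_of_ne_zero ht₁)] at h1
  have h2 := Module.finrank_mul_finrank K
    (IntermediateField.fixedField (Subgroup.zpowers (σ ^ t₁))) L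
  rw [h1, h] at h2
  exact Nat.eq_of_mul_eq_mul_right (Nat.pos_of_mul_pos_left hpos) h2

/-- A proper subfield of degree `t` over `K` yields a product-injective pair of subspaces
of dimension `t`. -/
theorem exists_isProductInjective_of_mul [Finite K] {t₁ t₂ : ℕ}
    (h : Module.finrank K L = t₁ * t₂) (ht : 2 ≤ t₂) :
    ∃ A B : Submodule K L, Module.finrank K A = t₁ ∧ Module.finrank K B = t₁ ∧
      IsProductInjective A B := by
  obtain ⟨F, hF⟩ := exists_intermediateField_finrank_eq h
  have : Finite L := Module.finite_of_finite K
  obtain ⟨σ, -, -, hσ⟩ := exists_algEquiv_forall_mem_zpowers (K := K) (L := L)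
  have hpos : 0 < t₁ * t₂ := h ▸ Module.finrank_pos
  have hFtop : F ≠ ⊤ := by
    rintro rfl
    rw [IntermediateField.finrank_top', h] at hF
    nlinarith [Nat.pos_of_mul_pos_right hpos]
  obtain ⟨γ, hγ⟩ : ∃ γ, γ ∉ F := by
    by_contra! hall
    exact hFtop (eq_top_iff.2 fun x _ => hall x)
  have hσF : ∀ y ∈ F, σ y ∈ F := by
    intro y hy
    have := IntermediateField.normal_iff_forall_map_le'.1 (inferInstance : Normal K F) σ
    exact this ⟨y, hy, rfl⟩
  obtain ⟨B, hB, hAB⟩ := isProductInjective_twist (A := Subalgebra.toSubmodule F.toSubalgebra)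
    (Y := Subalgebra.toSubmodule F.toSubalgebra) (W := Subalgebra.toSubmodule F.toSubalgebra) σ hσ
    (γ := γ) (fun u hu v hv huv => by
      by_contra hv0
      refine hγ ?_
      rw [← mul_div_cancel_right₀ γ hv0, ← huv]
      exact F.div_mem hu hv)
    ((Submodule.ne_bot_iff _).2 ⟨1, F.one_mem, one_ne_zero⟩) (fun a ha y hy => F.mul_mem ha hy)
    (fun a ha y hy => F.mul_mem ha (hσF y hy))
  exact ⟨_, B, hF, hB.symm.trans hF, hAB⟩

/-- Otherwise every `γ` is a ratio of elements of `W`; since `|W|² ≤ |L|`, division `W × W → L`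
would then be bijective. -/
theorem exists_forall_eq_mul_imp_eq_zero [Finite K] {W : Submodule K L}
    (h : 2 * Module.finrank K W ≤ Module.finrank K L) :
    ∃ γ : L, ∀ u ∈ W, ∀ v ∈ W, u = γ * v → v = 0 := by
  have : Finite L := Module.finite_of_finite K
  by_contra! hall
  have hsurj : Function.Surjective fun p : W × W => (p.1 : L) / p.2 := by
    intro γ
    obtain ⟨u, hu, v, hv, huv, hv0⟩ := hall γ
    exact ⟨(⟨u, hu⟩, ⟨v, hv⟩), by simp [huv, hv0]⟩
  have hinj := (hsurj.bijective_of_nat_card_le (by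
    rw [Nat.card_prod, Module.natCard_eq_pow_finrank (K := K) (V := W),
      Module.natCard_eq_pow_finrank (K := K) (V := L), ← pow_add]
    exact Nat.pow_le_pow_right Nat.card_pos (by omega))).1
  obtain ⟨u, hu, v, hv, huv, hv0⟩ := hall 0
  -- Division by zero has value 0, so these two pairs collide; `v ≠ 0` comes from the case `γ = 0`.
  have := @hinj (⟨v, hv⟩, 0) (0, 0) (by simp)
  simp only [Prod.mk.injEq, and_true, Submodule.mk_eq_zero] at this
  exact hv0 this

/-- `g` maps the kernel of `f * g` into that of `f`, with kernel inside that of `g`. -/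
theorem finrank_ker_comp_le {E : Type*} [AddCommGroup E] [Module K E] [FiniteDimensional K E]
    (f g : E →ₗ[K] E) : Module.finrank K (LinearMap.ker (f * g)) ≤
      Module.finrank K (LinearMap.ker f) + Module.finrank K (LinearMap.ker g) := by
  have h := LinearMap.finrank_range_add_finrank_ker (g.domRestrict (LinearMap.ker (f * g)))
  have h1 : LinearMap.range (g.domRestrict (LinearMap.ker (f * g))) ≤ LinearMap.ker f := by
    rintro _ ⟨⟨x, hx⟩, rfl⟩
    exact hx
  have h2 := Submodule.finrank_mono h1
  have h3 : Module.finrank K (LinearMap.ker (g.domRestrict (LinearMap.ker (f * g)))) ≤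
      Module.finrank K (LinearMap.ker g) := by
    rw [LinearMap.ker_domRestrict]
    refine LinearMap.finrank_le_finrank_of_injective
      (f := (Submodule.subtype _).restrict (p := _) (q := LinearMap.ker g) fun x hx => hx) ?_
    rintro ⟨x, hx⟩ ⟨y, hy⟩ hxy
    have h := Subtype.ext_iff.1 hxy
    exact Subtype.ext (Subtype.ext h)
  omega

/-- Each factor `N` adds at most 1 to the kernel dimension, and `dim E` factors must fill `E`, so no
step can fall short. -/
theorem finrank_ker_pow_eq {E : Type*} [AddCommGroup E] [Module K E] [FiniteDimensional K E]
    {N : Module.End K E} (hN : Module.finrank K (LinearMap.ker N) ≤ 1)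
    (hpow : N ^ Module.finrank K E = 0) {i : ℕ} (hi : i ≤ Module.finrank K E) :
    Module.finrank K (LinearMap.ker (N ^ i)) = i := by
  have hle : ∀ j, Module.finrank K (LinearMap.ker (N ^ j)) ≤ j := by
    intro j
    induction j with
    | zero => simp [Module.End.one_eq_id]
    | succ j ih =>
      have := finrank_ker_comp_le (N ^ j) N
      rw [pow_succ]
      omega
  have h := finrank_ker_comp_le (N ^ (Module.finrank K E - i)) (N ^ i)
  rw [← pow_add, Nat.sub_add_cancel hi, hpow, LinearMap.ker_zero, finrank_top] at h
  have h1 := hle i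
  have h2 := hle (Module.finrank K E - i)
  omega

/-- In characteristic `p`, `(σ - 1) ^ (p ^ r) = σ ^ (p ^ r) - 1 = 0`, and `σ - 1` has kernel `K`, so
its powers have kernels of every dimension up to `m`. These serve as `A`, `Y` and `W` in the twist.
-/
theorem exists_isProductInjective_of_prime_pow [Finite K] {p r n₁ n₂ : ℕ} [Fact p.Prime]
    [CharP K p] (hm : Module.finrank K L = p ^ r) (hn₁ : 0 < n₁) (hn₂ : 0 < n₂)
    (h : 2 * (n₁ + n₂ - 1) ≤ Module.finrank K L) :
    ∃ A B : Submodule K L, Module.finrank K A = n₁ ∧ Module.finrank K B = n₂ ∧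
      IsProductInjective A B := by
  obtain ⟨σ, -, hord, hσ⟩ := exists_algEquiv_forall_mem_zpowers (K := K) (L := L)
  set N : Module.End K L := σ.toLinearMap - 1 with hN
  have hpow : N ^ Module.finrank K L = 0 := by
    have : CharP (Module.End K L) p :=
      charP_of_injective_algebraMap (algebraMap K (Module.End K L)).injective p
    rw [hm, hN, sub_pow_char_pow_of_commute _ _ (Commute.one_right _), one_pow, sub_eq_zero, ← hm,
      ← hord]
    have hσm := pow_orderOf_eq_one σ
    ext x
    have := DFunLike.congr_fun hσm x
    rw [Module.End.pow_apply]
    rw [AlgEquiv.coe_pow] at this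
    exact this
  have hker : Module.finrank K (LinearMap.ker N) ≤ 1 := by
    refine finrank_le_one ⟨1, by simp [hN]⟩ ?_
    rintro ⟨x, hx⟩
    obtain ⟨c, rfl⟩ := hσ x (by simpa [hN, sub_eq_zero] using hx)
    exact ⟨c, Subtype.ext (by simp [Algebra.smul_def])⟩
  have hdim : ∀ i ≤ Module.finrank K L, Module.finrank K (LinearMap.ker (N ^ i)) = i :=
    fun i => finrank_ker_pow_eq hker hpow
  obtain ⟨i, rfl⟩ := Nat.exists_eq_add_of_le' hn₁
  obtain ⟨j, rfl⟩ := Nat.exists_eq_add_of_le' hn₂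
  -- `i + j + 1` is `n₁ + n₂ - 1`, the dimension bounded by half the degree.
  obtain ⟨γ, hγ⟩ := exists_forall_eq_mul_imp_eq_zero (W := LinearMap.ker (N ^ (i + j + 1)))
    (by rw [hdim _ (by omega)]; omega)
  have hσN : ∀ y ∈ LinearMap.ker (N ^ (j + 1)), σ y ∈ LinearMap.ker (N ^ (j + 1)) := by
    intro y hy
    have : σ y = N y + y := by simp [hN]
    rw [this]
    refine Submodule.add_mem _ ?_ hy
    rw [LinearMap.mem_ker, ← Module.End.mul_apply, ← pow_succ, pow_succ', Module.End.mul_apply,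
      LinearMap.mem_ker.1 hy, map_zero]
  have hA : Module.finrank K (LinearMap.ker (N ^ (i + 1))) = i + 1 := hdim _ (by omega)
  obtain ⟨B, hB, hAB⟩ := isProductInjective_twist (A := LinearMap.ker (N ^ (i + 1)))
    (Y := LinearMap.ker (N ^ (j + 1))) σ hσ hγ
    (by intro hbot; rw [hbot, finrank_bot] at hA; omega)
    (fun a ha y hy => mul_mem_ker_sub_one_pow σ i j ha hy)
    (fun a ha y hy => mul_mem_ker_sub_one_pow σ i j ha (hσN y hy))
  exact ⟨_, B, hA, hB.symm.trans (hdim _ (by omega)), hAB⟩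

/-! ### Scattered subspaces -/

/-- A subspace that meets every line over the intermediate field `F` in at most a `K`-line. -/
def IsScattered (F : IntermediateField K L) (B : Submodule K L) : Prop :=
  ∀ b ∈ B, ∀ b' ∈ B, ∀ c ∈ F, b' ≠ 0 → b = c * b' → ∃ d : K, b = d • b'

/-- Greedy extension: `B + K v` stays scattered if `v` avoids all `c b' + b` with `c ∈ F` and `b, b'
∈ B`. There are `|F| |B|²` such triples, at most `|L|`. -/
theorem exists_isScattered [Finite K] (F : IntermediateField K L) (d : ℕ)
    (hd : 2 * d + Module.finrank K F ≤ Module.finrank K L + 2) :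
    ∃ B : Submodule K L, Module.finrank K B = d ∧ IsScattered F B := by
  have : Finite L := Module.finite_of_finite K
  induction d with
  | zero => exact ⟨⊥, by simp, fun b _ b' hb' _ _ hb0 => absurd (by simpa using hb') hb0⟩
  | succ d ih =>
    obtain ⟨B, hBd, hB⟩ := ih (by omega)
    obtain ⟨v, hv⟩ : ∃ v, ∀ c ∈ F, ∀ b' ∈ B, ∀ b ∈ B, v ≠ c * b' + b := by
      by_contra! hall
      have hsurj : Function.Surjective fun p : F × B × B => (p.1 : L) * p.2.1 + p.2.2 := by
        intro v
        obtain ⟨c, hc, b', hb', b, hb, h⟩ := hall v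
        exact ⟨(⟨c, hc⟩, ⟨b', hb'⟩, ⟨b, hb⟩), h.symm⟩
      have hinj := (hsurj.bijective_of_nat_card_le (by
        rw [Nat.card_prod, Nat.card_prod, Module.natCard_eq_pow_finrank (K := K) (V := F),
          Module.natCard_eq_pow_finrank (K := K) (V := B),
          Module.natCard_eq_pow_finrank (K := K) (V := L), ← pow_add, ← pow_add]
        exact Nat.pow_le_pow_right Nat.card_pos (by omega))).1
      -- This collision settles even the borderline case `|F| |B|² = |L|`.
      have := @hinj (1, 0, 0) (0, 0, 0) (by simp)
      simp at this
    have hvB : v ∉ B := fun h => hv 0 F.zero_mem 0 B.zero_mem v h (by simp)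
    refine ⟨B ⊔ Submodule.span K {v}, by rw [Submodule.finrank_sup_span_singleton hvB, hBd], ?_⟩
    intro a ha a' ha' c hc ha0 hac
    obtain ⟨b, hb, w, hw, rfl⟩ := Submodule.mem_sup.1 ha
    obtain ⟨b', hb', w', hw', rfl⟩ := Submodule.mem_sup.1 ha'
    obtain ⟨x, rfl⟩ := Submodule.mem_span_singleton.1 hw
    obtain ⟨x', rfl⟩ := Submodule.mem_span_singleton.1 hw'
    have hF : ∀ z : K, algebraMap K L z ∈ F := F.algebraMap_mem
    by_cases hx' : x' = 0
    · subst hx'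
      rw [zero_smul, add_zero] at hac ha0 ⊢
      by_cases hx : x = 0
      · subst hx
        rw [zero_smul, add_zero] at hac ⊢
        exact hB b hb b' hb' c hc ha0 hac
      -- Solving `b + x v = c b'` for `v` gives an excluded vector.
      · refine absurd ?_ (hv (c / algebraMap K L x) (F.div_mem hc (hF x)) b' hb' (-(x⁻¹ • b))
          (B.neg_mem (B.smul_mem _ hb)))
        have hx0 : algebraMap K L x ≠ 0 := by simpa using hx
        simp only [Algebra.smul_def, map_inv₀] at hac ⊢
        field_simp
        linear_combination hac
    · by_cases hcx : c = algebraMap K L (x / x')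
      · exact ⟨x / x', by rw [hac, hcx, ← Algebra.smul_def]⟩
      · have hx0 : algebraMap K L x' ≠ 0 := by simpa using hx'
        -- Subtracting `x / x'` times `b' + x' v` removes `v` from the left side: `b - (x / x') b' =
        -- e (b' + x' v)`. As `e ≠ 0`, this again expresses `v` in the excluded form.
        set e := c - algebraMap K L (x / x') with he
        have he0 : e ≠ 0 := sub_ne_zero.2 hcx
        have heF : e ∈ F := F.sub_mem hc (hF _)
        refine absurd ?_ (hv (e * algebraMap K L x')⁻¹ (F.inv_mem (F.mul_mem heF (hF _)))
          (b - (x / x') • b') (B.sub_mem hb (B.smul_mem _ hb')) (-(x'⁻¹ • b'))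
          (B.neg_mem (B.smul_mem _ hb')))
        have hkey : b - (x / x') • b' = e * (b' + x' • v) := by
          simp only [he, Algebra.smul_def, map_div₀] at hac ⊢
          field_simp
          linear_combination algebraMap K L x' * hac
        rw [hkey]
        simp only [Algebra.smul_def, map_inv₀]
        field_simp
        ring

/-- With `A = F` a subfield, `a b' = a' b` puts `b` and `b'` on one `F`-line, so scatteredness
applies. -/
theorem exists_isProductInjective_of_isScattered [Finite K] {t₁ t₂ d : ℕ}
    (h : Module.finrank K L = t₁ * t₂) (hd : 2 * d + t₁ ≤ t₁ * t₂ + 2) :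
    ∃ A B : Submodule K L, Module.finrank K A = t₁ ∧ Module.finrank K B = d ∧
      IsProductInjective A B := by
  obtain ⟨F, hF⟩ := exists_intermediateField_finrank_eq h
  obtain ⟨B, hBd, hB⟩ := exists_isScattered F d (by rwa [hF, h])
  refine ⟨Subalgebra.toSubmodule F.toSubalgebra, B, hF, hBd, isProductInjective_of_ratio ?_⟩
  intro a ha a' ha' b hb b' hb' ha0 hb0 hab
  refine hB b hb b' hb' (a / a') (F.div_mem ha ha') hb0 ?_
  rw [div_mul_eq_mul_div, hab, mul_div_cancel_left₀ _ ha0]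

end

/-! ### The five sufficient conditions -/

theorem theorem4p3 {K L : Type*} [Field K] [Finite K] [Field L] [Algebra K L]
    [FiniteDimensional K L] (q m n₁ n₂ : ℕ)
    (hq : Nat.card K = q) (hm : Module.finrank K L = m)
    (hn₁ : 2 ≤ n₁) (hn₂ : 2 ≤ n₂)
    (h : (Even m ∧ 2 * max n₁ n₂ ≤ m) ∨
      n₁ * n₂ ≤ m ∨
      (∃ t₁ t₂ : ℕ, m = t₁ * t₂ ∧ n₁ ≤ t₁ ∧ (n₂ : ℝ) ≤ (t₁ : ℝ) * ((t₂ : ℝ) - 1) / 2 + 1) ∨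
      (∃ t₁ t₂ : ℕ, m = t₁ * t₂ ∧ n₁ ≤ t₁ ∧ n₂ ≤ t₁ ∧ 2 ≤ t₂) ∨
      (∃ p e r : ℕ, p.Prime ∧ q = p ^ e ∧ m = p ^ r ∧ (n₁ : ℝ) + (n₂ : ℝ) - 1 ≤ (m : ℝ) / 2)) :
    QMatroid.IsRepresentable L
      (QMatroid.coordSum (QMatroid.uniform K 1 n₁) (QMatroid.uniform K 1 n₂)) := by
  rcases h with ⟨⟨k, hk⟩, hle⟩ | h | ⟨t₁, t₂, ht, h₁, h₂⟩ | ⟨t₁, t₂, ht, h₁, h₂, h₃⟩ |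
    ⟨p, e, r, hp, hqp, hmp, hle⟩
  -- The subfield of degree `m / 2`: the twist with `t₂ = 2`.
  · obtain ⟨A, B, hA, hB, hAB⟩ := exists_isProductInjective_of_mul (K := K) (L := L)
      (hm.trans (hk.trans (mul_two k).symm)) le_rfl
    exact QMatroid.isRepresentable_of_isProductInjective (by omega) (by omega) hAB
  · obtain ⟨A, B, hA, hB, hAB⟩ := exists_isProductInjective_of_mul_le (K := K) (L := L)
      (by omega : 0 < n₁) (by omega : 0 < n₂) (hm ▸ h)
    exact QMatroid.isRepresentable_of_isProductInjective hA hB hAB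
  · have hd : 2 * n₂ + t₁ ≤ t₁ * t₂ + 2 := by
      have : (2 * n₂ + t₁ : ℝ) ≤ t₁ * t₂ + 2 := by linarith
      exact_mod_cast this
    obtain ⟨A, B, hA, hB, hAB⟩ := exists_isProductInjective_of_isScattered (K := K) (L := L)
      (hm.trans ht) hd
    exact QMatroid.isRepresentable_of_isProductInjective (hA ▸ h₁) hB.ge hAB
  · obtain ⟨A, B, hA, hB, hAB⟩ := exists_isProductInjective_of_mul (K := K) (L := L)
      (hm.trans ht) h₃
    exact QMatroid.isRepresentable_of_isProductInjective (hA ▸ h₁) (hB ▸ h₂) hAB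
  · have : Fact p.Prime := ⟨hp⟩
    have : Fintype K := Fintype.ofFinite K
    -- The characteristic `l` divides `q = p ^ e`, hence equals `p`.
    have : CharP K p := by
      obtain ⟨l, hl⟩ := CharP.exists K
      have hl' : l.Prime := CharP.char_is_prime K l
      obtain ⟨s, -, hs⟩ := FiniteField.card K l
      rw [← Nat.card_eq_fintype_card, hq, hqp] at hs
      have hdvd : l ∣ p ^ e := hs ▸ dvd_pow_self l s.ne_zero
      rwa [(Nat.prime_dvd_prime_iff_eq hl' hp).1 (hl'.dvd_of_dvd_pow hdvd)] at hl
    have hle' : 2 * (n₁ + n₂ - 1) ≤ m := by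
      have : (2 * (n₁ + n₂) : ℝ) ≤ m + 2 := by linarith
      have : 2 * (n₁ + n₂) ≤ m + 2 := by exact_mod_cast this
      omega
    obtain ⟨A, B, hA, hB, hAB⟩ := exists_isProductInjective_of_prime_pow (K := K) (L := L)
      (hm.trans hmp) (by omega : 0 < n₁) (by omega : 0 < n₂) (hm ▸ hle')
    exact QMatroid.isRepresentable_of_isProductInjective hA.ge hB.ge hAB
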